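/- Let $X_1,X_2,\dots$ be independent, identically distributed real random variables with characteristic function $\phi(s)=\mathbb{E}\,e^{isX_1}$, $s\in\mathbb{R}$ (for example, stable random variables). Fix $t\in\mathbb{R}$ and put $$Z_n(t)=\frac1n\sum_{k=1}^n\begin{bmatrix}\cos(tX_k)\\ \sin(tX_k)\end{bmatrix},\qquad Z_0(t)=\begin{bmatrix}\operatorname{Re}\phi(t)\\ \operatorname{Im}\phi(t)\end{bmatrix}.$$ Then, as $n\to\infty$, $$\sqrt n\,[Z_n(t)-Z_0(t)]\xrightarrow{d}\mathcal N(0,\Sigma_z),\qquad \Sigma_z=\begin{bmatrix}\sigma_{11}&\sigma_{12}\\ \sigma_{21}&\sigma_{22}\end{bmatrix},$$ where $$\sigma_{11}=\tfrac14\left[\phi(2t)+2+\phi(-2t)-\phi(t)^2-2\phi(t)\phi(-t)-\phi(-t)^2\right],$$ $$\sigma_{22}=\tfrac14\left[\phi(t)^2-2\phi(t)\phi(-t)+\phi(-t)^2\right]-\tfrac14\left[\phi(2t)+\phi(-2t)-2\right],$$ $$\sigma_{12}=\sigma_{21}=\tfrac1{4i}\left[\phi(2t)-\phi(t)^2-\phi(-2t)+\phi(-t)^2\right].$$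 These entries are real and $\Sigma_z$ is positive semidefinite; the normal law is allowed to be degenerate. -/

import Mathlib

open MeasureTheory ProbabilityTheory Filter

noncomputable section

/-- The random vector `(1/n) ∑_{k < n} (cos (t X_k), sin (t X_k))`, that is, the real and imaginary
parts at `t` of the empirical characteristic function of the first `n` terms of `X`. -/
def ecfVector {Ω : Type*} (X : ℕ → Ω → ℝ) (t : ℝ) (n : ℕ) (ω : Ω) : EuclideanSpace ℝ (Fin 2) :=
  (1 / (n : ℝ)) • ∑ k ∈ Finset.range n, !₂[Real.cos (t * X k ω), Real.sin (t * X k ω)]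

/-- The vector `(Re φ(t), Im φ(t))`. -/
def cfVector (φ : ℝ → ℂ) (t : ℝ) : EuclideanSpace ℝ (Fin 2) :=
  !₂[(φ t).re, (φ t).im]

/-- The entries of the asymptotic covariance matrix, as complex expressions in
`φ(t), φ(-t), φ(2t), φ(-2t)`. -/
def sigmaZ (φ : ℝ → ℂ) (t : ℝ) : Matrix (Fin 2) (Fin 2) ℂ :=
  let σ₁₁ : ℂ := 1 / 4 *
    (φ (2 * t) + 2 + φ (-2 * t) - (φ t) ^ 2 - 2 * φ t * φ (-t) - (φ (-t)) ^ 2)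
  let σ₂₂ : ℂ := 1 / 4 * ((φ t) ^ 2 - 2 * φ t * φ (-t) + (φ (-t)) ^ 2)
    - 1 / 4 * (φ (2 * t) + φ (-2 * t) - 2)
  let σ₁₂ : ℂ := 1 / (4 * Complex.I) *
    (φ (2 * t) - (φ t) ^ 2 - φ (-2 * t) + (φ (-t)) ^ 2)
  !![σ₁₁, σ₁₂; σ₁₂, σ₂₂]

end

open scoped Matrix RealInnerProductSpace

/-! The vectors (cos tX_k, sin tX_k) are bounded and i.i.d., so the vector central limit theorem
applies. It follows from the scalar one by Cramér–Wold: each projection on u is asymptotically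
Gaussian with variance uᵀSu, where S is the covariance matrix. Double-angle formulas express S
through φ(t) and φ(2t), and φ(-s) = conj φ(s) turns this into the stated complex entries. -/

section MultivariateCLT

variable {Ω Ω' E ι : Type*} {mΩ : MeasurableSpace Ω} {mΩ' : MeasurableSpace Ω'}

/-- The characteristic function of a random vector, read off from a one-dimensional projection. -/
theorem charFun_map_eq_charFun_map_inner [NormedAddCommGroup E] [InnerProductSpace ℝ E]
    [MeasurableSpace E] [BorelSpace E]
    {P : Measure Ω} {Y : Ω → E} (hY : AEMeasurable Y P) (u : E) :
    charFun (P.map Y) u = charFun (P.map fun ω ↦ ⟪u, Y ω⟫) 1 := by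
  have hm : Measurable fun x : E ↦ ⟪u, x⟫ := (continuous_const.inner continuous_id).measurable
  rw [← Function.comp_def (fun x : E ↦ ⟪u, x⟫) Y, ← hm.aemeasurable.map_map_of_aemeasurable hY,
    charFun_apply, charFun_apply, integral_map hm.aemeasurable (by fun_prop)]
  simp [real_inner_comm]

/-- **Cramér–Wold theorem**. -/
theorem tendstoInDistribution_of_forall_inner [NormedAddCommGroup E] [InnerProductSpace ℝ E]
    [FiniteDimensional ℝ E] [MeasurableSpace E] [BorelSpace E]
    {P : Measure Ω} [IsProbabilityMeasure P] {P' : Measure Ω'} [IsProbabilityMeasure P']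
    {Y : ℕ → Ω → E} {Z : Ω' → E} (hY : ∀ n, AEMeasurable (Y n) P) (hZ : AEMeasurable Z P')
    (h : ∀ u : E, TendstoInDistribution (fun n ω ↦ ⟪u, Y n ω⟫) atTop (fun ω ↦ ⟪u, Z ω⟫)
      (fun _ ↦ P) P') :
    TendstoInDistribution Y atTop Z (fun _ ↦ P) P' where
  forall_aemeasurable := hY
  aemeasurable_limit := hZ
  tendsto := by
    refine ProbabilityMeasure.tendsto_iff_tendsto_charFun.2 fun u ↦ ?_
    -- Frequency 1 suffices because u already ranges over all vectors.
    have := ProbabilityMeasure.tendsto_iff_tendsto_charFun.1 (h u).tendsto 1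
    simpa [charFun_map_eq_charFun_map_inner (hY _), charFun_map_eq_charFun_map_inner hZ] using this

variable [Fintype ι] {P : Measure Ω} [IsProbabilityMeasure P]

/-- The covariance matrix of a random vector. -/
noncomputable def covarianceMatrix (Y : Ω → EuclideanSpace ℝ ι) (P : Measure Ω) : Matrix ι ι ℝ :=
  Matrix.of fun i j ↦ cov[fun ω ↦ Y ω i, fun ω ↦ Y ω j; P]

/-- Bilinearity of covariance. This yields positive semidefiniteness and matches the variances of
the projections in the limit law. -/
theorem dotProduct_covarianceMatrix_mulVec {Y : Ω → EuclideanSpace ℝ ι} (hY : MemLp Y 2 P)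
    (u : EuclideanSpace ℝ ι) :
    u ⬝ᵥ covarianceMatrix Y P *ᵥ u = Var[fun ω ↦ ⟪u, Y ω⟫; P] := by
  have hi (i : ι) : MemLp (fun ω ↦ u i * Y ω i) 2 P := (hY.eval_piLp i).const_mul _
  have h : (fun ω ↦ ⟪u, Y ω⟫) = fun ω ↦ ∑ i, u i * Y ω i := by
    ext ω
    simp [PiLp.inner_apply, mul_comm]
  rw [h, variance_fun_sum hi]
  simp_rw [covariance_const_mul_left, covariance_const_mul_right]
  simp only [dotProduct, Matrix.mulVec, covarianceMatrix, Matrix.of_apply, Finset.mul_sum]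
  refine Finset.sum_congr rfl fun i _ ↦ Finset.sum_congr rfl fun j _ ↦ ?_
  ring

theorem posSemidef_covarianceMatrix {Y : Ω → EuclideanSpace ℝ ι} (hY : MemLp Y 2 P) :
    (covarianceMatrix Y P).PosSemidef := by
  refine .of_dotProduct_mulVec_nonneg ?_ fun u ↦ ?_
  · ext i j
    simp [covarianceMatrix, covariance_comm]
  · have := dotProduct_covarianceMatrix_mulVec hY (WithLp.toLp 2 u)
    simp only [star_trivial] at this ⊢
    exact this ▸ variance_nonneg _ _

/-- Both characteristic functions at r equal exp(-r² uᵀSu / 2). A degenerate S is allowed. -/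
theorem map_inner_multivariateGaussian [DecidableEq ι] {S : Matrix ι ι ℝ} (hS : S.PosSemidef)
    (u : EuclideanSpace ℝ ι) :
    (multivariateGaussian 0 S).map (fun x ↦ ⟪u, x⟫) = gaussianReal 0 (u ⬝ᵥ S *ᵥ u).toNNReal := by
  have h0 : 0 ≤ u ⬝ᵥ S *ᵥ u := by simpa using hS.dotProduct_mulVec_nonneg u.ofLp
  refine Measure.ext_of_charFun (funext fun r ↦ ?_)
  have h : charFun ((multivariateGaussian 0 S).map fun x ↦ ⟪u, x⟫) r
      = charFun (multivariateGaussian 0 S) (r • u) := by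
    rw [charFun_apply, charFun_apply, integral_map (by fun_prop) (by fun_prop)]
    simp [real_inner_smul_right, real_inner_comm, mul_comm]
  rw [h, charFun_multivariateGaussian hS, charFun_gaussianReal]
  simp only [inner_zero_right, Complex.ofReal_zero, zero_mul, mul_zero, zero_sub,
    Real.coe_toNNReal _ h0, WithLp.ofLp_smul, Matrix.mulVec_smul,
    smul_dotProduct, dotProduct_smul, smul_eq_mul]
  push_cast
  ring_nf

/-- **Central limit theorem** for random vectors in a Euclidean space. -/
theorem tendstoInDistribution_multivariateGaussian [DecidableEq ι]
    {Y : ℕ → Ω → EuclideanSpace ℝ ι} (hY : MemLp (Y 0) 2 P) (hindep : iIndepFun Y P)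
    (hident : ∀ k, IdentDistrib (Y k) (Y 0) P P) :
    TendstoInDistribution
      (fun (n : ℕ) ω ↦ (√n)⁻¹ • (∑ k ∈ Finset.range n, Y k ω - (n : ℝ) • ∫ ω, Y 0 ω ∂P))
      atTop id (fun _ ↦ P) (multivariateGaussian 0 (covarianceMatrix (Y 0) P)) := by
  have hm (k : ℕ) : AEMeasurable (Y k) P := (hident k).aemeasurable_fst
  refine tendstoInDistribution_of_forall_inner (fun n ↦ ?_) aemeasurable_id fun u ↦ ?_
  · exact AEMeasurable.const_smul
      ((Finset.aemeasurable_fun_sum _ fun k _ ↦ hm k).sub aemeasurable_const) (√(n : ℝ))⁻¹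
  have hu : Measurable fun x : EuclideanSpace ℝ ι ↦ ⟪u, x⟫ := by fun_prop
  have hlaw : HasLaw (fun x ↦ ⟪u, id x⟫) (gaussianReal 0 Var[fun ω ↦ ⟪u, Y 0 ω⟫; P].toNNReal)
      (multivariateGaussian 0 (covarianceMatrix (Y 0) P)) :=
    ⟨hu.aemeasurable, by
      simpa [dotProduct_covarianceMatrix_mulVec hY u] using
        map_inner_multivariateGaussian (posSemidef_covarianceMatrix hY) u⟩
  have key := tendstoInDistribution_inv_sqrt_mul_sum_sub (X := fun k ω ↦ ⟪u, Y k ω⟫) hlaw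
    (hY.const_inner u) (hindep.comp (fun _ x ↦ ⟪u, x⟫) fun _ ↦ hu)
    fun k ↦ (hident k).comp hu
  have hint : ∫ ω, ⟪u, Y 0 ω⟫ ∂P = ⟪u, ∫ ω, Y 0 ω ∂P⟫ :=
    integral_inner (hY.integrable (by norm_num)) u
  simpa only [real_inner_smul_right, inner_sub_right, inner_sum, hint] using key

end MultivariateCLT

section EmpiricalCharacteristicFunction

variable {Ω : Type*} {mΩ : MeasurableSpace Ω} {P : Measure Ω} [IsProbabilityMeasure P] {X : Ω → ℝ}

theorem integrable_cexp_mul_I (hX : AEMeasurable X P) (s : ℝ) :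
    Integrable (fun ω ↦ Complex.exp (s * X ω * Complex.I)) P := by
  refine Integrable.of_bound (C := 1) (by fun_prop) (.of_forall fun ω ↦ ?_)
  rw [← Complex.ofReal_mul, Complex.norm_exp_ofReal_mul_I]

omit [IsProbabilityMeasure P] in
theorem charFun_map_eq_integral (hX : AEMeasurable X P) (s : ℝ) :
    charFun (P.map X) s = ∫ ω, Complex.exp (s * X ω * Complex.I) ∂P := by
  rw [charFun_apply_real, integral_map hX (by fun_prop)]

theorem integral_cos_eq_re_charFun (hX : AEMeasurable X P) (s : ℝ) :
    ∫ ω, Real.cos (s * X ω) ∂P = (charFun (P.map X) s).re := by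
  rw [charFun_map_eq_integral hX, ← RCLike.re_eq_complex_re,
    ← integral_re (integrable_cexp_mul_I hX s)]
  simp [← Complex.ofReal_mul, Complex.exp_ofReal_mul_I_re]

theorem integral_sin_eq_im_charFun (hX : AEMeasurable X P) (s : ℝ) :
    ∫ ω, Real.sin (s * X ω) ∂P = (charFun (P.map X) s).im := by
  rw [charFun_map_eq_integral hX, ← RCLike.im_eq_complex_im,
    ← integral_im (integrable_cexp_mul_I hX s)]
  simp [← Complex.ofReal_mul, Complex.exp_ofReal_mul_I_im]

theorem memLp_cos (hX : AEMeasurable X P) (s : ℝ) : MemLp (fun ω ↦ Real.cos (s * X ω)) 2 P :=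
  MemLp.of_bound (C := 1) (by fun_prop) (.of_forall fun _ ↦ Real.abs_cos_le_one _)

theorem memLp_sin (hX : AEMeasurable X P) (s : ℝ) : MemLp (fun ω ↦ Real.sin (s * X ω)) 2 P :=
  MemLp.of_bound (C := 1) (by fun_prop) (.of_forall fun _ ↦ Real.abs_sin_le_one _)

theorem covariance_cos_cos (hX : AEMeasurable X P) (s : ℝ) :
    cov[fun ω ↦ Real.cos (s * X ω), fun ω ↦ Real.cos (s * X ω); P]
      = (1 + (charFun (P.map X) (2 * s)).re) / 2 - (charFun (P.map X) s).re ^ 2 := by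
  rw [covariance_eq_sub (memLp_cos hX s) (memLp_cos hX s), integral_cos_eq_re_charFun hX]
  have h : ((fun ω ↦ Real.cos (s * X ω)) * fun ω ↦ Real.cos (s * X ω))
      = fun ω ↦ (1 + Real.cos (2 * s * X ω)) / 2 := by
    ext ω
    simp only [Pi.mul_apply, mul_assoc 2 s, Real.cos_two_mul]
    ring
  rw [h, integral_div, integral_add (integrable_const _)
    ((memLp_cos hX _).integrable (by norm_num)), integral_cos_eq_re_charFun hX]
  simp [sq]

theorem covariance_sin_sin (hX : AEMeasurable X P) (s : ℝ) :
    cov[fun ω ↦ Real.sin (s * X ω), fun ω ↦ Real.sin (s * X ω); P]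
      = (1 - (charFun (P.map X) (2 * s)).re) / 2 - (charFun (P.map X) s).im ^ 2 := by
  rw [covariance_eq_sub (memLp_sin hX s) (memLp_sin hX s), integral_sin_eq_im_charFun hX]
  have h : ((fun ω ↦ Real.sin (s * X ω)) * fun ω ↦ Real.sin (s * X ω))
      = fun ω ↦ (1 - Real.cos (2 * s * X ω)) / 2 := by
    ext ω
    simp only [Pi.mul_apply, mul_assoc 2 s, Real.cos_two_mul, Real.cos_sq']
    ring
  rw [h, integral_div, integral_sub (integrable_const _)
    ((memLp_cos hX _).integrable (by norm_num)), integral_cos_eq_re_charFun hX]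
  simp [sq]

theorem covariance_cos_sin (hX : AEMeasurable X P) (s : ℝ) :
    cov[fun ω ↦ Real.cos (s * X ω), fun ω ↦ Real.sin (s * X ω); P]
      = (charFun (P.map X) (2 * s)).im / 2
        - (charFun (P.map X) s).re * (charFun (P.map X) s).im := by
  rw [covariance_eq_sub (memLp_cos hX s) (memLp_sin hX s), integral_cos_eq_re_charFun hX,
    integral_sin_eq_im_charFun hX]
  have h : ((fun ω ↦ Real.cos (s * X ω)) * fun ω ↦ Real.sin (s * X ω))
      = fun ω ↦ Real.sin (2 * s * X ω) / 2 := by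
    ext ω
    simp only [Pi.mul_apply, mul_assoc 2 s, Real.sin_two_mul]
    ring
  rw [h, integral_div, integral_sin_eq_im_charFun hX]

/-- The vector `(cos (t x), sin (t x))`. -/
noncomputable def trigVector (t x : ℝ) : EuclideanSpace ℝ (Fin 2) := !₂[Real.cos (t * x), Real.sin (t * x)]

theorem measurable_trigVector (t : ℝ) : Measurable (trigVector t) := by
  refine (WithLp.measurable_toLp 2 _).comp (measurable_pi_iff.2 fun i ↦ ?_)
  fin_cases i <;> simp <;> fun_prop

theorem memLp_trigVector (hX : AEMeasurable X P) (t : ℝ) :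
    MemLp (fun ω ↦ trigVector t (X ω)) 2 P :=
  .of_eval_piLp fun i ↦ by
    fin_cases i
    · exact memLp_cos hX t
    · exact memLp_sin hX t

theorem integral_trigVector (hX : AEMeasurable X P) (t : ℝ) :
    ∫ ω, trigVector t (X ω) ∂P = cfVector (charFun (P.map X)) t := by
  ext i
  rw [eval_integral_piLp fun i ↦ ((memLp_trigVector hX t).eval_piLp i).integrable (by norm_num)]
  fin_cases i
  · exact integral_cos_eq_re_charFun hX t
  · exact integral_sin_eq_im_charFun hX t

theorem covarianceMatrix_trigVector (hX : AEMeasurable X P) (t : ℝ) :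
    (covarianceMatrix (fun ω ↦ trigVector t (X ω)) P).map Complex.ofReal
      = sigmaZ (charFun (P.map X)) t := by
  have hc := covariance_cos_cos hX t
  have hs := covariance_sin_sin hX t
  have hcs := covariance_cos_sin hX t
  have hsc := hcs
  rw [covariance_comm] at hsc
  ext i j
  -- With φ(-s) = conj φ(s), each complex entry has zero imaginary part and the covariance as real
  -- part.
  fin_cases i <;> fin_cases j <;>
    simp [covarianceMatrix, trigVector, sigmaZ, hc, hs, hcs, hsc, charFun_neg] <;>
    apply Complex.ext <;> simp [sq] <;> ring

end EmpiricalCharacteristicFunction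

/-- Central limit theorem for the empirical characteristic function at a fixed point `t`.
The existentially quantified real matrix `S` is determined by `S.map Complex.ofReal = sigmaZ φ t`:
that clause says that the entries given by the complex formulas are real. -/
theorem proposition1 {Ω : Type*} [MeasurableSpace Ω] (P : Measure Ω) [IsProbabilityMeasure P]
    (X : ℕ → Ω → ℝ) (hindep : iIndepFun X P) (hident : ∀ k, IdentDistrib (X k) (X 0) P P)
    (φ : ℝ → ℂ) (hφ : ∀ s : ℝ, φ s = charFun (P.map (X 0)) s) (t : ℝ) :
    ∃ S : Matrix (Fin 2) (Fin 2) ℝ,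
      S.map Complex.ofReal = sigmaZ φ t ∧ S.PosSemidef ∧
      TendstoInDistribution
        (fun (n : ℕ) (ω : Ω) ↦ Real.sqrt n • (ecfVector X t n ω - cfVector φ t))
        atTop id (fun _ ↦ P) (multivariateGaussian 0 S) := by
  obtain rfl : φ = charFun (P.map (X 0)) := funext hφ
  have hX : AEMeasurable (X 0) P := (hident 0).aemeasurable_fst
  refine ⟨covarianceMatrix (fun ω ↦ trigVector t (X 0 ω)) P, covarianceMatrix_trigVector hX t,
    posSemidef_covarianceMatrix (memLp_trigVector hX t), ?_⟩
  have key := tendstoInDistribution_multivariateGaussian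
    (Y := fun k ω ↦ trigVector t (X k ω)) (memLp_trigVector hX t)
    (hindep.comp (fun _ ↦ trigVector t) fun _ ↦ measurable_trigVector t)
    fun k ↦ (hident k).comp (measurable_trigVector t)
  convert key using 3 with n ω
  rw [integral_trigVector hX, ecfVector]
  change √n • ((1 / (n : ℝ)) • ∑ k ∈ Finset.range n, trigVector t (X k ω) - _) = _
  -- At n = 0 both sides vanish. Otherwise √n = n / √n moves the factor n inside and cancels the 1/n
  -- of the mean.
  obtain rfl | hn := Nat.eq_zero_or_pos n
  · simp
  have hn' : (0 : ℝ) < n := by exact_mod_cast hn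
  have h : √(n : ℝ) = (√n)⁻¹ * n := by
    rw [eq_inv_mul_iff_mul_eq₀ (Real.sqrt_pos.2 hn').ne', Real.mul_self_sqrt hn'.le]
  nth_rw 1 [h]
  rw [mul_smul, smul_sub (n : ℝ), smul_smul (n : ℝ), mul_one_div_cancel hn'.ne', one_smul]
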